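/- Let $k\ge 3$ be an integer, $b_3,\dots,b_k$ and $a_{ij}$ $(2\le i+j\le k)$ real numbers with $a_{02}>0$, and let $f_0$ be the Whitney umbrella normal form $$f_0(u,v)=\Bigl(u,\;uv+\sum_{i=3}^k\frac{b_i}{i!}v^i+R_2(u,v),\;\sum_{j=2}^k\sum_{i=0}^j\frac{a_{i,j-i}}{i!\,(j-i)!}u^iv^{j-i}+R_3(u,v)\Bigr),$$ where $R_2,R_3$ are $C^\infty$ functions on an open neighbourhood $W$ of the origin in $\mathbb R^2$ all of whose derivatives of order $\le k$ vanish at the origin. Let $n=\dfrac{(f_0)_u\times (f_0)_v}{|(f_0)_u\times (f_0)_v|}$ be the unit normal away from the origin. For $r\ne0$ put $h(\theta)=f_0(r\cos\theta,r\sin\theta)$, and let $$\kappa_g(r,\theta)=\Bigl\langle \frac{(h_{\theta\theta})^{\tan}}{|h_\theta|^2},\; n\times\frac{h_\theta}{|h_\theta|}\Bigr\rangle$$ be the geodesic curvature of this curve on the surface $f_0$, where $n$ is evaluated at $(r\cos\theta,r\sin\theta)$ and $(h_{\theta\theta})^{\tan}=h_{\theta\theta}-\langle n,h_{\theta\theta}\rangle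 n$ is the component of $h_{\theta\theta}$ tangent to the surface. Put $$\mathcal A(\theta)=\sqrt{\cos^2\theta+(a_{11}\cos\theta+a_{02}\sin\theta)^2},$$ $$g(s)=(a_{11}^2+1)s^4+a_{11}a_{02}s^3+3(a_{11}^2+1)s^2+a_{11}(4a_{02}-a_{20})s+a_{02}(a_{02}-a_{20}).$$ Then there is $\varepsilon>0$ such that the following hold. 1. For $0<|r|<\varepsilon$ and every $\theta$, the point $(r\cos\theta,r\sin\theta)$ lies in $W$ and $f_0$ is an immersion there, and $h_\theta(\theta)\ne0$ if $\sin\theta\neq0$; so $\kappa_g(r,\theta)$ is defined whenever $0<|r|<\varepsilon$ and $\sin\theta\ne0$. 2. $\kappa_g$ extends to a $C^\infty$ function of $(r,\theta)$ on $\{(r,\theta):|r|<\varepsilon,\ \sin\theta\ne0\}$, whose value at $r=0$ is $\dfrac{|\sin\theta|}{\mathcal A(\theta)}\,g(\cot\theta)$. 3. For $\sin\theta\ne0$, $$\kappa_g(r,\theta)=\frac{|\sin\theta|}{\mathcal A(\theta)}\,g\!\left(\frac{\cos\theta}{\sin\theta}\right)+O(r),$$ where the error is at most $C|r|$ for all $0<|r|<\varepsilon$,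 with $C$ uniform for $\theta$ in any given compact subset of $\{\sin\theta\ne0\}$. -/

import Mathlib

open scoped ContDiff

noncomputable section

namespace WhitneyUmbrella

/-- Euclidean three-space. -/
abbrev E3 : Type := EuclideanSpace ℝ (Fin 3)

/-- The vector product of Euclidean three-space. -/
def cross (x y : E3) : E3 := WithLp.toLp 2 (crossProduct x.ofLp y.ofLp)

/-- `R` is a function germ at the origin of the plane of order at least `m`:
all its derivatives of order less than `m` vanish there. -/
def HasOrderGE (R : ℝ × ℝ → ℝ) (m : ℕ) : Prop :=
  ∀ i < m, iteratedFDeriv ℝ i R 0 = 0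

/-- The polynomial `B(v) = ∑_{i=3}^k b_i v^i / i!`. -/
def B (k : ℕ) (b : ℕ → ℝ) (v : ℝ) : ℝ :=
  ∑ i ∈ Finset.Icc 3 k, b i / (Nat.factorial i : ℝ) * v ^ i

/-- The form `A_j(u,v) = ∑_{i=0}^j a_{i,j-i} u^i v^(j-i) / (i! (j-i)!)`. -/
def A (a : ℕ → ℕ → ℝ) (j : ℕ) (u v : ℝ) : ℝ :=
  ∑ i ∈ Finset.range (j + 1),
    a i (j - i) / ((Nat.factorial i : ℝ) * (Nat.factorial (j - i) : ℝ)) * u ^ i * v ^ (j - i)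

/-- The normal form of a Whitney umbrella
`(u, v) ↦ (u, u v + B(v) + R₂(u,v), ∑_{j=2}^k A_j(u,v) + R₃(u,v))` with remainders `R₂`, `R₃`. -/
def normalForm (k : ℕ) (b : ℕ → ℝ) (a : ℕ → ℕ → ℝ) (R₂ R₃ : ℝ × ℝ → ℝ) (p : ℝ × ℝ) : E3 :=
  !₂[p.1,
     p.1 * p.2 + B k b p.2 + R₂ p,
     (∑ j ∈ Finset.Icc 2 k, A a j p.1 p.2) + R₃ p]

/-- `f_u × f_v` for a parametrized surface `f`. -/
def normalVector (f : ℝ × ℝ → E3) (p : ℝ × ℝ) : E3 :=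
  cross (fderiv ℝ f p (1, 0)) (fderiv ℝ f p (0, 1))

/-- The unit normal vector `f_u × f_v / |f_u × f_v|` (meaningful where `f` is an immersion). -/
def unitNormal (f : ℝ × ℝ → E3) (p : ℝ × ℝ) : E3 :=
  ‖normalVector f p‖⁻¹ • normalVector f p

/-- The covariant acceleration along `f` of the curve `f ∘ γ`: the component of the second
derivative of `f ∘ γ` tangent to the surface `f`. -/
def covariantAcceleration (f : ℝ × ℝ → E3) (γ : ℝ → ℝ × ℝ) (t : ℝ) : E3 :=
  deriv (deriv (f ∘ γ)) t
    - inner ℝ (unitNormal f (γ t)) (deriv (deriv (f ∘ γ)) t) • unitNormal f (γ t)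

/-- The geodesic curvature vector: the covariant acceleration divided by the squared speed.
(It differs from the covariant derivative of the unit tangent with respect to arc length by
a multiple of the tangent vector, which does not affect `geodesicCurvature`.) -/
def geodesicCurvatureVector (f : ℝ × ℝ → E3) (γ : ℝ → ℝ × ℝ) (t : ℝ) : E3 :=
  (‖deriv (f ∘ γ) t‖ ^ 2)⁻¹ • covariantAcceleration f γ t

/-- The geodesic curvature on the surface `f` of the curve `f ∘ γ`: the inner product of the
geodesic curvature vector with `n × e`, where `n` is the unit normal of `f` and
`e` the unit tangent of the curve. -/
def geodesicCurvature (f : ℝ × ℝ → E3) (γ : ℝ → ℝ × ℝ) (t : ℝ) : ℝ :=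
  inner ℝ (geodesicCurvatureVector f γ t)
    (cross (unitNormal f (γ t)) (‖deriv (f ∘ γ) t‖⁻¹ • deriv (f ∘ γ) t))

/-- The circle `γ(θ) = (r cos θ, r sin θ)`. -/
def circle (r θ : ℝ) : ℝ × ℝ := (r * Real.cos θ, r * Real.sin θ)

/-- `κ_g(r, θ)`: the geodesic curvature at `θ` of the image under `f` of the circle with
constant `r`. -/
def kappaG (f : ℝ × ℝ → E3) (r θ : ℝ) : ℝ := geodesicCurvature f (circle r) θ

/-- `𝒜(θ) = √(cos² θ + (a₁₁ cos θ + a₀₂ sin θ)²)`. -/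
def calA (a₁₁ a₀₂ θ : ℝ) : ℝ :=
  Real.sqrt (Real.cos θ ^ 2 + (a₁₁ * Real.cos θ + a₀₂ * Real.sin θ) ^ 2)

/-- The quartic `g(s)`. -/
def g (a₂₀ a₁₁ a₀₂ s : ℝ) : ℝ :=
  (a₁₁ ^ 2 + 1) * s ^ 4 + a₁₁ * a₀₂ * s ^ 3 + 3 * (a₁₁ ^ 2 + 1) * s ^ 2
    + a₁₁ * (4 * a₀₂ - a₂₀) * s + a₀₂ * (a₀₂ - a₂₀)

/-- The leading term `(|sin θ| / 𝒜(θ)) g(cos θ / sin θ)`. -/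
def leadingTerm (a₂₀ a₁₁ a₀₂ θ : ℝ) : ℝ :=
  |Real.sin θ| / calA a₁₁ a₀₂ θ * g a₂₀ a₁₁ a₀₂ (Real.cos θ / Real.sin θ)

end WhitneyUmbrella

end

noncomputable section

namespace WhitneyUmbrella

/-! In polar coordinates the singularity of the umbrella is only a power of `r`. Near the origin the
surface is `(r cos θ, r² P, r² Q)` with `P`, `Q` smooth across `r = 0`: homogeneous terms supply
their powers of `r` directly, and the remainders do so by Hadamard's lemma
(`exists_polar_eq_pow_smul`).

The normal vector then has norm `|r| √N`, the velocity of the circle `|r| √S`, and the triple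
product of normal, velocity and acceleration equals `r⁴ T`, with `N`, `S`, `T` smooth in `(r, θ)`.
Since `κ_g` is the triple product divided by the first norm and the cube of the second, all powers
of `r` cancel, signs included because 4 is even (`IsPolarForm.kappaG_eq`). What remains, `T / (√N
√S³)`, is smooth wherever `N` and `S` are positive.

At `r = 0` one finds `N = 𝒜²`, `S = sin² θ` and `T = sin⁴ θ · g(cot θ)`, which is the leading term.
Positivity of `N` persists for small `r`, uniformly in `θ`, by compactness of the circle; the `O(r)`
bound is the mean value inequality in `r`. -/

/-! ### Parameter integrals, cut-offs and Hadamard division in polar coordinates -/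

theorem contDiff_intervalIntegral_of_nat {X : Type} [NormedAddCommGroup X] [NormedSpace ℝ X]
    [ProperSpace X] (n : ℕ) : ∀ {G : Type} [NormedAddCommGroup G] [NormedSpace ℝ G]
    [CompleteSpace G] {F : X × ℝ → G}, ContDiff ℝ ∞ F →
    ContDiff ℝ n (fun x => ∫ t in (0 : ℝ)..1, F (x, t)) := by
  induction n with
  | zero =>
    intro G _ _ _ F hF
    refine contDiff_zero.2 ?_
    exact intervalIntegral.continuous_parametric_intervalIntegral_of_continuous' (f := fun x t => F (x, t))
      hF.continuous 0 1
  | succ n ih =>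
    -- The derivative of the integral is the integral of a map with values in `X →L[ℝ] G`, so the
    -- induction has to let the target space vary.
    intro G _ _ _ F hF
    have hF' : ContDiff ℝ ∞
        (fun q : X × ℝ => (fderiv ℝ F q).comp (ContinuousLinearMap.inl ℝ X ℝ)) :=
      (hF.fderiv_right (m := ∞) (by simp)).clm_comp contDiff_const
    refine contDiff_succ_iff_hasFDerivAt.2 ⟨_, ih hF', fun x₀ => ?_⟩
    obtain ⟨C, hC⟩ := ((isCompact_closedBall x₀ 1).prod (isCompact_Icc (a := (0 : ℝ)) (b := 1))).exists_bound_of_continuousOn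
      hF'.continuous.continuousOn
    have hc : ∀ x, Continuous fun t : ℝ => F (x, t) := fun x =>
      hF.continuous.comp (by fun_prop)
    have hc' : Continuous fun t : ℝ => (fderiv ℝ F (x₀, t)).comp (ContinuousLinearMap.inl ℝ X ℝ) :=
      hF'.continuous.comp (by fun_prop : Continuous fun t : ℝ => (x₀, t))
    refine intervalIntegral.hasFDerivAt_integral_of_dominated_of_fderiv_le
      (F := fun x t => F (x, t)) (bound := fun _ => C)
      (F' := fun x t => (fderiv ℝ F (x, t)).comp (ContinuousLinearMap.inl ℝ X ℝ))
      (Metric.closedBall_mem_nhds x₀ one_pos)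
      (.of_forall fun x => (hc x).aestronglyMeasurable) ((hc x₀).intervalIntegrable _ _)
      hc'.aestronglyMeasurable ?_ intervalIntegrable_const ?_
    · refine .of_forall fun t ht x hx => hC (x, t) ⟨hx, ?_⟩
      rw [Set.uIoc_of_le zero_le_one] at ht
      exact ⟨ht.1.le, ht.2⟩
    · refine .of_forall fun t _ x _ => ?_
      exact ((hF.differentiable (by simp)) (x, t)).hasFDerivAt.comp x
        (hasFDerivAt_prodMk_left x t)

/-- Integrals of a smooth function over `[0, 1]` depend smoothly on parameters. -/
theorem contDiff_intervalIntegral {X G : Type} [NormedAddCommGroup X] [NormedSpace ℝ X]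
    [ProperSpace X] [NormedAddCommGroup G] [NormedSpace ℝ G] [CompleteSpace G] {F : X × ℝ → G}
    (hF : ContDiff ℝ ∞ F) : ContDiff ℝ ∞ (fun x => ∫ t in (0 : ℝ)..1, F (x, t)) :=
  contDiff_infty.2 fun n => contDiff_intervalIntegral_of_nat n hF

/-- A smooth function on a neighbourhood of `x` agrees near `x` with a globally smooth one. -/
theorem exists_contDiff_eventuallyEq {X : Type} [NormedAddCommGroup X] [NormedSpace ℝ X]
    [FiniteDimensional ℝ X] {R : X → ℝ} {W : Set X} (hW : IsOpen W) {x : X} (hx : x ∈ W)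
    (hR : ContDiffOn ℝ ∞ R W) : ∃ S : X → ℝ, ContDiff ℝ ∞ S ∧ S =ᶠ[nhds x] R := by
  obtain ⟨δ, hδ, hδW⟩ := Metric.isOpen_iff.1 hW x hx
  let f : ContDiffBump x := ⟨δ / 4, δ / 2, by positivity, by linarith⟩
  refine ⟨fun y => f y * R y, ?_, ?_⟩
  · refine contDiff_iff_contDiffAt.2 fun y => ?_
    by_cases hy : y ∈ W
    · exact f.contDiff.contDiffAt.mul (hR.contDiffAt (hW.mem_nhds hy))
    -- The bump is supported in a closed ball contained in `W`, so the product vanishes near any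
    -- point outside `W`, whatever values `R` has there.
    · have : (fun z => f z * R z) =ᶠ[nhds y] fun _ => 0 := by
        have hy' : y ∈ (Metric.closedBall x (δ / 2))ᶜ := fun h =>
          hy (hδW (Metric.closedBall_subset_ball (by linarith) h))
        filter_upwards [Metric.isClosed_closedBall.isOpen_compl.mem_nhds hy'] with z hz
        have : f z = 0 := f.zero_of_le_dist (by
          simpa [f] using (not_le.1 (fun h => hz (Metric.mem_closedBall.2 h))).le)
        simp [this]
      exact contDiffAt_const.congr_of_eventuallyEq this
  · filter_upwards [f.eventuallyEq_one] with y hy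
    simp [hy]

theorem contDiff_circle : ContDiff ℝ ∞ fun q : ℝ × ℝ => circle q.1 q.2 := by
  unfold circle
  exact (contDiff_fst.mul (Real.contDiff_cos.comp contDiff_snd)).prodMk
    (contDiff_fst.mul (Real.contDiff_sin.comp contDiff_snd))

theorem smul_circle (t r θ : ℝ) : t • circle r θ = circle (t * r) θ := by
  simp [circle, mul_assoc]

theorem circle_eq_smul (r θ : ℝ) : circle r θ = r • circle 1 θ := by
  simp [circle]

/-- A smooth function vanishing at the origin to order `m` is, in polar coordinates, divisible
by `r ^ m`. -/
theorem exists_polar_eq_pow_smul (m : ℕ) : ∀ {G : Type} [NormedAddCommGroup G] [NormedSpace ℝ G]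
    [CompleteSpace G] {φ : ℝ × ℝ → G}, ContDiff ℝ ∞ φ →
    (∀ i < m, iteratedFDeriv ℝ i φ 0 = 0) →
    ∃ ψ : ℝ × ℝ → G, ContDiff ℝ ∞ ψ ∧ ∀ r θ, φ (circle r θ) = r ^ m • ψ (r, θ) := by
  induction m with
  | zero =>
    intro G _ _ _ φ hφ _
    exact ⟨fun q => φ (circle q.1 q.2), hφ.comp contDiff_circle, by simp⟩
  | succ m ih =>
    intro G _ _ _ φ hφ h0
    obtain ⟨Ψ, hΨ, hΨe⟩ := ih (φ := fderiv ℝ φ) (hφ.fderiv_right (by simp)) (fun i hi => by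
      rw [← norm_eq_zero, norm_iteratedFDeriv_fderiv, h0 _ (by omega), norm_zero])
    have hφ0 : φ 0 = 0 := by
      have := h0 0 (by omega)
      rw [← norm_eq_zero, norm_iteratedFDeriv_zero] at this
      simpa using this
    -- From `φ(x) = ∫₀¹ Dφ(tx) x dt`: by induction `Dφ` contributes `(tr)^m Ψ`, and `x = r • circle
    -- 1 θ` contributes one more `r`.
    refine ⟨fun q => ∫ t in (0 : ℝ)..1, t ^ m • Ψ (t * q.1, q.2) (circle 1 q.2), ?_, ?_⟩
    · refine contDiff_intervalIntegral
        (F := fun p : (ℝ × ℝ) × ℝ => p.2 ^ m • Ψ (p.2 * p.1.1, p.1.2) (circle 1 p.1.2)) ?_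
      refine (contDiff_snd.pow m).smul (ContDiff.clm_apply (hΨ.comp ?_) ?_)
      · fun_prop
      · exact contDiff_circle.comp (by fun_prop : ContDiff ℝ ∞ fun p : (ℝ × ℝ) × ℝ => ((1 : ℝ), p.1.2))
    · intro r θ
      have hd : ∀ t : ℝ, HasDerivAt (fun t : ℝ => φ (t • circle r θ))
          (r ^ (m + 1) • (t ^ m • Ψ (t * r, θ) (circle 1 θ))) t := by
        intro t
        have h1 : HasDerivAt (fun t : ℝ => t • circle r θ) ((1 : ℝ) • circle r θ) t :=
          (hasDerivAt_id t).smul_const _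
        have h2 := ((hφ.differentiable (by simp)) (t • circle r θ)).hasFDerivAt.comp_hasDerivAt t h1
        refine h2.congr_deriv ?_
        rw [smul_circle, hΨe, one_smul, circle_eq_smul r θ, mul_pow]
        simp only [_root_.smul_apply, map_smul, smul_smul]
        congr 1
        ring
      have hcont : Continuous fun t : ℝ => r ^ (m + 1) • (t ^ m • Ψ (t * r, θ) (circle 1 θ)) := by
        have := hΨ.continuous
        fun_prop
      have := intervalIntegral.integral_eq_sub_of_hasDerivAt (a := 0) (b := 1) (fun t _ => hd t)
        (hcont.intervalIntegrable _ _)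
      rw [intervalIntegral.integral_smul] at this
      simpa [hφ0] using this.symm

/-! ### Partial derivatives, vector algebra and the triple product formula -/

/-- The partial derivative with respect to the radius. -/
def radialDeriv (F : ℝ × ℝ → ℝ) (q : ℝ × ℝ) : ℝ := fderiv ℝ F q (1, 0)

/-- The partial derivative with respect to the angle. -/
def angularDeriv (F : ℝ × ℝ → ℝ) (q : ℝ × ℝ) : ℝ := fderiv ℝ F q (0, 1)

theorem contDiff_radialDeriv {F : ℝ × ℝ → ℝ} (hF : ContDiff ℝ ∞ F) :
    ContDiff ℝ ∞ (radialDeriv F) :=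
  (hF.fderiv_right (by simp)).clm_apply contDiff_const

theorem contDiff_angularDeriv {F : ℝ × ℝ → ℝ} (hF : ContDiff ℝ ∞ F) :
    ContDiff ℝ ∞ (angularDeriv F) :=
  (hF.fderiv_right (by simp)).clm_apply contDiff_const

theorem hasDerivAt_radial {F : ℝ × ℝ → ℝ} {r θ : ℝ} (hF : DifferentiableAt ℝ F (r, θ)) :
    HasDerivAt (fun t => F (t, θ)) (radialDeriv F (r, θ)) r :=
  hF.hasFDerivAt.comp_hasDerivAt r ((hasDerivAt_id r).prodMk (hasDerivAt_const r θ))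

theorem hasDerivAt_angular {F : ℝ × ℝ → ℝ} {r θ : ℝ} (hF : DifferentiableAt ℝ F (r, θ)) :
    HasDerivAt (fun t => F (r, t)) (angularDeriv F (r, θ)) θ :=
  hF.hasFDerivAt.comp_hasDerivAt θ ((hasDerivAt_const θ r).prodMk (hasDerivAt_id θ))

theorem hasDerivAt_vec3 {x y z : ℝ → ℝ} {x' y' z' t : ℝ} (hx : HasDerivAt x x' t)
    (hy : HasDerivAt y y' t) (hz : HasDerivAt z z' t) :
    HasDerivAt (fun t => (!₂[x t, y t, z t] : E3)) !₂[x', y', z'] t := by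
  have h : HasDerivAt (fun t => ![x t, y t, z t]) ![x', y', z'] t := by
    refine hasDerivAt_pi.2 fun i => ?_
    fin_cases i
    exacts [hx, hy, hz]
  exact (PiLp.continuousLinearEquiv 2 ℝ (fun _ : Fin 3 => ℝ)).symm.hasFDerivAt.comp_hasDerivAt t h

theorem inner_vec3 (x₀ x₁ x₂ y₀ y₁ y₂ : ℝ) :
    inner ℝ (!₂[x₀, x₁, x₂] : E3) !₂[y₀, y₁, y₂] = x₀ * y₀ + x₁ * y₁ + x₂ * y₂ := by
  simp [PiLp.inner_apply, Fin.sum_univ_three, mul_comm]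

theorem norm_vec3 (x₀ x₁ x₂ : ℝ) :
    ‖(!₂[x₀, x₁, x₂] : E3)‖ = Real.sqrt (x₀ ^ 2 + x₁ ^ 2 + x₂ ^ 2) := by
  simp [EuclideanSpace.norm_eq, Fin.sum_univ_three]

theorem cross_vec3 (x₀ x₁ x₂ y₀ y₁ y₂ : ℝ) :
    cross (!₂[x₀, x₁, x₂] : E3) !₂[y₀, y₁, y₂] =
      !₂[x₁ * y₂ - x₂ * y₁, x₂ * y₀ - x₀ * y₂, x₀ * y₁ - x₁ * y₀] := by
  simp [cross, cross_apply]

theorem cross_smul_smul (c d : ℝ) (x y : E3) : cross (c • x) (d • y) = (c * d) • cross x y := by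
  simp [cross, smul_smul, mul_comm]

theorem inner_self_cross (x y : E3) : inner ℝ x (cross x y) = 0 := by
  simp [cross, cross_apply, PiLp.inner_apply, Fin.sum_univ_three]
  ring

/-- A rotation of the arguments does not change the vector product. -/
theorem cross_rotate (x y : E3) {c s : ℝ} (h : c ^ 2 + s ^ 2 = 1) :
    cross (c • x - s • y) (s • x + c • y) = cross x y := by
  ext i
  fin_cases i <;> simp [cross, cross_apply]
  · linear_combination (x 1 * y 2 - x 2 * y 1) * h
  · linear_combination (x 2 * y 0 - x 0 * y 2) * h
  · linear_combination (x 0 * y 1 - x 1 * y 0) * h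

/-- The tangential projection in the definition of the geodesic curvature is immaterial. -/
theorem geodesicCurvature_eq (f : ℝ × ℝ → E3) (γ : ℝ → ℝ × ℝ) (t : ℝ) :
    geodesicCurvature f γ t = ‖normalVector f (γ t)‖⁻¹ * ‖deriv (f ∘ γ) t‖⁻¹ ^ 3 *
      inner ℝ (deriv (deriv (f ∘ γ)) t) (cross (normalVector f (γ t)) (deriv (f ∘ γ) t)) := by
  simp only [geodesicCurvature, geodesicCurvatureVector, covariantAcceleration, unitNormal,
    cross_smul_smul, inner_smul_left, inner_smul_right, inner_sub_left, inner_self_cross]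
  simp
  ring

/-! ### Desingularized quantities in polar coordinates -/

/-- The surface `f` is `(r cos θ, r² P(r, θ), r² Q(r, θ))` in polar coordinates on `|r| < δ`, and
differentiable away from the origin. -/
structure IsPolarForm (f : ℝ × ℝ → E3) (P Q : ℝ × ℝ → ℝ) (δ : ℝ) : Prop where
  smooth_snd : ContDiff ℝ ∞ P
  smooth_thd : ContDiff ℝ ∞ Q
  differentiableAt : ∀ r θ, 0 < |r| → |r| < δ → DifferentiableAt ℝ f (circle r θ)
  eq_polar : ∀ r θ, |r| < δ →
    f (circle r θ) = !₂[r * Real.cos θ, r ^ 2 * P (r, θ), r ^ 2 * Q (r, θ)]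

/-- The first component of the normal vector in polar coordinates, up to the factor `r ^ 2`. -/
def polarNormal₁ (P Q : ℝ × ℝ → ℝ) (q : ℝ × ℝ) : ℝ :=
  (2 * P q + q.1 * radialDeriv P q) * angularDeriv Q q
    - (2 * Q q + q.1 * radialDeriv Q q) * angularDeriv P q

/-- The second component of the normal vector in polar coordinates, up to the factor `r`. -/
def polarNormal₂ (Q : ℝ × ℝ → ℝ) (q : ℝ × ℝ) : ℝ :=
  -(Real.sin q.2 * (2 * Q q + q.1 * radialDeriv Q q) + Real.cos q.2 * angularDeriv Q q)

/-- The third component of the normal vector in polar coordinates, up to the factor `r`. -/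
def polarNormal₃ (P : ℝ × ℝ → ℝ) (q : ℝ × ℝ) : ℝ :=
  Real.cos q.2 * angularDeriv P q + Real.sin q.2 * (2 * P q + q.1 * radialDeriv P q)

/-- The squared norm of the normal vector divided by `r ^ 2`. -/
def polarNormalSq (P Q : ℝ × ℝ → ℝ) (q : ℝ × ℝ) : ℝ :=
  (q.1 * polarNormal₁ P Q q) ^ 2 + polarNormal₂ Q q ^ 2 + polarNormal₃ P q ^ 2

/-- The squared speed of the image of a circle divided by `r ^ 2`. -/
def polarSpeedSq (P Q : ℝ × ℝ → ℝ) (q : ℝ × ℝ) : ℝ :=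
  (-Real.sin q.2) ^ 2 + (q.1 * angularDeriv P q) ^ 2 + (q.1 * angularDeriv Q q) ^ 2

/-- The triple product of the normal, the velocity and the acceleration divided by `r ^ 4`. -/
def polarTriple (P Q : ℝ × ℝ → ℝ) (q : ℝ × ℝ) : ℝ :=
  q.1 ^ 2 * polarNormal₁ P Q q *
      (angularDeriv P q * angularDeriv (angularDeriv Q) q
        - angularDeriv Q q * angularDeriv (angularDeriv P) q)
    + polarNormal₂ Q q *
      (Real.sin q.2 * angularDeriv (angularDeriv Q) q - Real.cos q.2 * angularDeriv Q q)
    + polarNormal₃ P q *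
      (Real.cos q.2 * angularDeriv P q - Real.sin q.2 * angularDeriv (angularDeriv P) q)

/-- The geodesic curvature in polar coordinates, free of the singularity at `r = 0`. -/
def polarCurvature (P Q : ℝ × ℝ → ℝ) (q : ℝ × ℝ) : ℝ :=
  (Real.sqrt (polarNormalSq P Q q))⁻¹ * (Real.sqrt (polarSpeedSq P Q q))⁻¹ ^ 3 * polarTriple P Q q

theorem contDiff_polarNormal₁ {P Q : ℝ × ℝ → ℝ} (hP : ContDiff ℝ ∞ P) (hQ : ContDiff ℝ ∞ Q) :
    ContDiff ℝ ∞ (polarNormal₁ P Q) := by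
  have h1 := contDiff_radialDeriv hP
  have h2 := contDiff_angularDeriv hP
  have h3 := contDiff_radialDeriv hQ
  have h4 := contDiff_angularDeriv hQ
  unfold polarNormal₁
  fun_prop

theorem contDiff_polarNormal₂ {Q : ℝ × ℝ → ℝ} (hQ : ContDiff ℝ ∞ Q) :
    ContDiff ℝ ∞ (polarNormal₂ Q) := by
  have h3 := contDiff_radialDeriv hQ
  have h4 := contDiff_angularDeriv hQ
  unfold polarNormal₂
  fun_prop

theorem contDiff_polarNormal₃ {P : ℝ × ℝ → ℝ} (hP : ContDiff ℝ ∞ P) :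
    ContDiff ℝ ∞ (polarNormal₃ P) := by
  have h1 := contDiff_radialDeriv hP
  have h2 := contDiff_angularDeriv hP
  unfold polarNormal₃
  fun_prop

theorem contDiff_polarNormalSq {P Q : ℝ × ℝ → ℝ} (hP : ContDiff ℝ ∞ P) (hQ : ContDiff ℝ ∞ Q) :
    ContDiff ℝ ∞ (polarNormalSq P Q) := by
  have h1 := contDiff_polarNormal₁ hP hQ
  have h2 := contDiff_polarNormal₂ hQ
  have h3 := contDiff_polarNormal₃ hP
  unfold polarNormalSq
  fun_prop

theorem contDiff_polarSpeedSq {P Q : ℝ × ℝ → ℝ} (hP : ContDiff ℝ ∞ P) (hQ : ContDiff ℝ ∞ Q) :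
    ContDiff ℝ ∞ (polarSpeedSq P Q) := by
  have h2 := contDiff_angularDeriv hP
  have h4 := contDiff_angularDeriv hQ
  unfold polarSpeedSq
  fun_prop

theorem contDiff_polarTriple {P Q : ℝ × ℝ → ℝ} (hP : ContDiff ℝ ∞ P) (hQ : ContDiff ℝ ∞ Q) :
    ContDiff ℝ ∞ (polarTriple P Q) := by
  have h1 := contDiff_polarNormal₁ hP hQ
  have h2 := contDiff_polarNormal₂ hQ
  have h3 := contDiff_polarNormal₃ hP
  have h4 := contDiff_angularDeriv hP
  have h5 := contDiff_angularDeriv hQ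
  have h6 := contDiff_angularDeriv h4
  have h7 := contDiff_angularDeriv h5
  unfold polarTriple
  fun_prop

theorem polarSpeedSq_pos {P Q : ℝ × ℝ → ℝ} {q : ℝ × ℝ} (hq : Real.sin q.2 ≠ 0) :
    0 < polarSpeedSq P Q q := by
  have : 0 < (-Real.sin q.2) ^ 2 := sq_pos_of_ne_zero (neg_ne_zero.2 hq)
  unfold polarSpeedSq
  positivity

theorem contDiffAt_polarCurvature {P Q : ℝ × ℝ → ℝ} (hP : ContDiff ℝ ∞ P) (hQ : ContDiff ℝ ∞ Q)
    {q : ℝ × ℝ} (hN : 0 < polarNormalSq P Q q) (hq : Real.sin q.2 ≠ 0) :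
    ContDiffAt ℝ ∞ (polarCurvature P Q) q := by
  have hS := polarSpeedSq_pos (P := P) (Q := Q) hq
  exact (((contDiff_polarNormalSq hP hQ).contDiffAt.sqrt hN.ne').inv
      (Real.sqrt_pos.2 hN).ne').mul
    ((((contDiff_polarSpeedSq hP hQ).contDiffAt.sqrt hS.ne').inv
      (Real.sqrt_pos.2 hS).ne').pow 3) |>.mul (contDiff_polarTriple hP hQ).contDiffAt

/-! ### Extracting the powers of `r` -/

variable {f : ℝ × ℝ → E3} {P Q : ℝ × ℝ → ℝ} {δ r : ℝ}

theorem IsPolarForm.hasDerivAt (h : IsPolarForm f P Q δ) (hr : |r| < δ) (θ : ℝ) :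
    HasDerivAt (f ∘ circle r)
      (r • !₂[-Real.sin θ, r * angularDeriv P (r, θ), r * angularDeriv Q (r, θ)]) θ := by
  have he : f ∘ circle r = fun θ => !₂[r * Real.cos θ, r ^ 2 * P (r, θ), r ^ 2 * Q (r, θ)] :=
    funext fun θ => h.eq_polar r θ hr
  rw [he]
  refine (hasDerivAt_vec3 ((Real.hasDerivAt_cos θ).const_mul r)
    ((hasDerivAt_angular (h.smooth_snd.differentiable (by simp) (r, θ))).const_mul (r ^ 2))
    ((hasDerivAt_angular (h.smooth_thd.differentiable (by simp) (r, θ))).const_mul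
      (r ^ 2))).congr_deriv ?_
  ext i
  fin_cases i <;> simp <;> ring

theorem IsPolarForm.deriv_deriv (h : IsPolarForm f P Q δ) (hr : |r| < δ) (θ : ℝ) :
    deriv (deriv (f ∘ circle r)) θ = r • !₂[-Real.cos θ,
      r * angularDeriv (angularDeriv P) (r, θ), r * angularDeriv (angularDeriv Q) (r, θ)] := by
  rw [funext fun θ => (h.hasDerivAt hr θ).deriv]
  refine (HasDerivAt.const_smul r ?_).deriv
  exact hasDerivAt_vec3 (Real.hasDerivAt_sin θ).neg
    ((hasDerivAt_angular ((contDiff_angularDeriv h.smooth_snd).differentiable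
      (by simp) (r, θ))).const_mul r)
    ((hasDerivAt_angular ((contDiff_angularDeriv h.smooth_thd).differentiable
      (by simp) (r, θ))).const_mul r)

theorem IsPolarForm.hasDerivAt_radial (h : IsPolarForm f P Q δ) (hr : |r| < δ) (θ : ℝ) :
    HasDerivAt (fun t => f (circle t θ))
      !₂[Real.cos θ, r * (2 * P (r, θ) + r * radialDeriv P (r, θ)),
        r * (2 * Q (r, θ) + r * radialDeriv Q (r, θ))] r := by
  have he : (fun t => f (circle t θ)) =ᶠ[nhds r]
      fun t => !₂[t * Real.cos θ, t ^ 2 * P (t, θ), t ^ 2 * Q (t, θ)] := by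
    filter_upwards [continuous_abs.continuousAt.eventually_lt continuousAt_const hr] with t ht
    exact h.eq_polar t θ ht
  refine HasDerivAt.congr_of_eventuallyEq ?_ he
  refine (hasDerivAt_vec3 ((hasDerivAt_id r).mul_const (Real.cos θ))
    ((hasDerivAt_pow 2 r).mul (WhitneyUmbrella.hasDerivAt_radial
      (h.smooth_snd.differentiable (by simp) (r, θ))))
    ((hasDerivAt_pow 2 r).mul (WhitneyUmbrella.hasDerivAt_radial
      (h.smooth_thd.differentiable (by simp) (r, θ))))).congr_deriv ?_
  ext i
  fin_cases i <;> simp <;> ring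

/-- The frame `(∂_r, r⁻¹ ∂_θ)` is a rotation of `(∂_u, ∂_v)`, so `f_u × f_v = f_r × r⁻¹ f_θ`, and
both factors are known from the polar form. -/
theorem IsPolarForm.normalVector_circle (h : IsPolarForm f P Q δ) (hr0 : 0 < |r|) (hr : |r| < δ)
    (θ : ℝ) : normalVector f (circle r θ) =
      r • !₂[r * polarNormal₁ P Q (r, θ), polarNormal₂ Q (r, θ), polarNormal₃ P (r, θ)] := by
  have hr' : r ≠ 0 := abs_pos.1 hr0
  have hf := (h.differentiableAt r θ hr0 hr).hasFDerivAt
  have h1 : HasDerivAt (fun t => circle t θ) (Real.cos θ, Real.sin θ) r := by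
    unfold circle
    simpa using ((hasDerivAt_id r).mul_const (Real.cos θ)).prodMk
      ((hasDerivAt_id r).mul_const (Real.sin θ))
  have h2 : HasDerivAt (circle r) (r • (-Real.sin θ, Real.cos θ)) θ :=
    ((Real.hasDerivAt_cos θ).const_mul r).prodMk ((Real.hasDerivAt_sin θ).const_mul r)
  have e1 := (hf.comp_hasDerivAt r h1).unique (h.hasDerivAt_radial hr θ)
  have e2 := (hf.comp_hasDerivAt θ h2).unique (h.hasDerivAt hr θ)
  rw [map_smul] at e2
  replace e2 := smul_right_injective E3 hr' e2
  have hcs : Real.cos θ ^ 2 + Real.sin θ ^ 2 = 1 := Real.cos_sq_add_sin_sq θ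
  have hu : ((1 : ℝ), (0 : ℝ)) = Real.cos θ • (Real.cos θ, Real.sin θ)
      - Real.sin θ • (-Real.sin θ, Real.cos θ) := by
    ext
    · simp; linear_combination -hcs
    · simp; ring
  have hv : ((0 : ℝ), (1 : ℝ)) = Real.sin θ • (Real.cos θ, Real.sin θ)
      + Real.cos θ • (-Real.sin θ, Real.cos θ) := by
    ext
    · simp; ring
    · simp; linear_combination -hcs
  rw [normalVector, hu, hv, map_sub, map_add]
  simp only [map_smul]
  rw [cross_rotate _ _ hcs, e1, e2, cross_vec3]
  ext i
  fin_cases i <;> simp [polarNormal₁, polarNormal₂, polarNormal₃] <;> ring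

theorem IsPolarForm.norm_normalVector (h : IsPolarForm f P Q δ) (hr0 : 0 < |r|) (hr : |r| < δ)
    (θ : ℝ) : ‖normalVector f (circle r θ)‖ = |r| * Real.sqrt (polarNormalSq P Q (r, θ)) := by
  rw [h.normalVector_circle hr0 hr, norm_smul, norm_vec3, Real.norm_eq_abs, polarNormalSq]

theorem IsPolarForm.norm_deriv (h : IsPolarForm f P Q δ) (hr : |r| < δ) (θ : ℝ) :
    ‖deriv (f ∘ circle r) θ‖ = |r| * Real.sqrt (polarSpeedSq P Q (r, θ)) := by
  rw [(h.hasDerivAt hr θ).deriv, norm_smul, norm_vec3, Real.norm_eq_abs, polarSpeedSq]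

theorem IsPolarForm.kappaG_eq (h : IsPolarForm f P Q δ) (hr0 : 0 < |r|) (hr : |r| < δ)
    (θ : ℝ) : kappaG f r θ = polarCurvature P Q (r, θ) := by
  rw [kappaG, geodesicCurvature_eq, h.norm_normalVector hr0 hr, h.norm_deriv hr,
    h.normalVector_circle hr0 hr, (h.hasDerivAt hr θ).deriv, h.deriv_deriv hr, cross_smul_smul,
    cross_vec3, real_inner_smul_left, real_inner_smul_right, inner_vec3, polarCurvature]
  -- One `|r|` comes from the normal and three from the speed, against `r⁴` in the triple product;
  -- the even exponent makes the sign of `r` irrelevant.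
  have hr4 : |r|⁻¹ ^ 4 * r ^ 4 = 1 := by
    rw [inv_pow, Even.pow_abs ⟨2, rfl⟩]
    exact inv_mul_cancel₀ (pow_ne_zero 4 (abs_pos.1 hr0))
  rw [mul_inv, mul_inv]
  linear_combination (Real.sqrt (polarNormalSq P Q (r, θ)))⁻¹ *
    (Real.sqrt (polarSpeedSq P Q (r, θ)))⁻¹ ^ 3 *
      (polarTriple P Q (r, θ) * hr4 - |r|⁻¹ ^ 4 * r ^ 4 * polarTriple.eq_1 P Q (r, θ))

/-! ### Polar form of the Whitney umbrella -/

theorem A_mul (a : ℕ → ℕ → ℝ) (j : ℕ) (r u v : ℝ) : A a j (r * u) (r * v) = r ^ j * A a j u v := by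
  rw [A, A, Finset.mul_sum]
  refine Finset.sum_congr rfl fun i hi => ?_
  have hj : r ^ j = r ^ i * r ^ (j - i) := by
    rw [← pow_add, Nat.add_sub_cancel' (Nat.lt_succ_iff.1 (Finset.mem_range.1 hi))]
  rw [hj, mul_pow, mul_pow]
  ring

theorem A_two (a : ℕ → ℕ → ℝ) (u v : ℝ) :
    A a 2 u v = a 2 0 / 2 * u ^ 2 + a 1 1 * u * v + a 0 2 / 2 * v ^ 2 := by
  simp [A, Finset.sum_range_succ]
  ring

theorem norm_circle_le (r θ : ℝ) : ‖circle r θ‖ ≤ |r| := by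
  refine max_le ?_ ?_ <;> simp only [circle, Real.norm_eq_abs, abs_mul]
  · exact mul_le_of_le_one_right (abs_nonneg r) (Real.abs_cos_le_one θ)
  · exact mul_le_of_le_one_right (abs_nonneg r) (Real.abs_sin_le_one θ)

/-- Hadamard division needs a globally smooth function; a cut-off provides one with the same germ at
the origin, hence the restriction to small `r`. -/
theorem HasOrderGE.exists_polar {R : ℝ × ℝ → ℝ} {m n : ℕ} {W : Set (ℝ × ℝ)} (hO : HasOrderGE R n)
    (hmn : m ≤ n) (hW : IsOpen W) (h0 : (0 : ℝ × ℝ) ∈ W) (hR : ContDiffOn ℝ ∞ R W) :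
    ∃ ψ : ℝ × ℝ → ℝ, ContDiff ℝ ∞ ψ ∧ ∃ δ > 0, ∀ r θ, |r| < δ →
      R (circle r θ) = r ^ m * ψ (r, θ) := by
  obtain ⟨S, hS, hSR⟩ := exists_contDiff_eventuallyEq hW h0 hR
  obtain ⟨ψ, hψ, hψe⟩ := exists_polar_eq_pow_smul m hS fun i hi => by
    rw [(hSR.iteratedFDeriv ℝ i).eq_of_nhds]
    exact hO i (hi.trans_le hmn)
  obtain ⟨δ, hδ, h⟩ := Metric.eventually_nhds_iff.1 hSR
  refine ⟨ψ, hψ, δ, hδ, fun r θ hr => ?_⟩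
  rw [← h (by simpa using (norm_circle_le r θ).trans_lt hr), hψe, smul_eq_mul]

theorem differentiableAt_normalForm (k : ℕ) (b : ℕ → ℝ) (a : ℕ → ℕ → ℝ) {R₂ R₃ : ℝ × ℝ → ℝ}
    {p : ℝ × ℝ} (h₂ : DifferentiableAt ℝ R₂ p) (h₃ : DifferentiableAt ℝ R₃ p) :
    DifferentiableAt ℝ (normalForm k b a R₂ R₃) p := by
  refine differentiableAt_euclidean.2 fun i => ?_
  fin_cases i <;> simp [normalForm, B, A] <;> fun_prop

/-- The normal form of a Whitney umbrella in polar coordinates. -/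
theorem exists_isPolarForm (k : ℕ) (hk : 2 ≤ k) (b : ℕ → ℝ) (a : ℕ → ℕ → ℝ)
    {W : Set (ℝ × ℝ)} (hW : IsOpen W) (h0 : (0 : ℝ × ℝ) ∈ W) {R₂ R₃ : ℝ × ℝ → ℝ}
    (hR₂ : ContDiffOn ℝ ∞ R₂ W) (hR₃ : ContDiffOn ℝ ∞ R₃ W)
    (hO₂ : HasOrderGE R₂ (k + 1)) (hO₃ : HasOrderGE R₃ (k + 1)) :
    ∃ (P Q : ℝ × ℝ → ℝ) (δ : ℝ), 0 < δ ∧ IsPolarForm (normalForm k b a R₂ R₃) P Q δ ∧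
      (∀ r θ, |r| < δ → circle r θ ∈ W) ∧
      (∀ θ, P (0, θ) = Real.cos θ * Real.sin θ) ∧
      ∀ θ, Q (0, θ) = A a 2 (Real.cos θ) (Real.sin θ) := by
  obtain ⟨ψ₂, hψ₂, δ₂, hδ₂, h₂⟩ := hO₂.exists_polar (m := 3) (by omega) hW h0 hR₂
  obtain ⟨ψ₃, hψ₃, δ₃, hδ₃, h₃⟩ := hO₃.exists_polar (m := 3) (by omega) hW h0 hR₃
  obtain ⟨δ₁, hδ₁, hδW⟩ := Metric.isOpen_iff.1 hW 0 h0
  have hmem : ∀ r θ, |r| < δ₁ → circle r θ ∈ W := fun r θ hr =>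
    hδW (by simpa using (norm_circle_le r θ).trans_lt hr)
  -- These are the last two coordinates divided by `r²`. Remainders of order 3 suffice: they leave a
  -- factor `r` and so do not affect `P`, `Q` at `r = 0`.
  refine ⟨fun q => Real.cos q.2 * Real.sin q.2 + q.1 *
      (∑ i ∈ Finset.Icc 3 k, b i / (Nat.factorial i : ℝ) * (q.1 ^ (i - 3) * Real.sin q.2 ^ i)
        + ψ₂ q),
    fun q => ∑ j ∈ Finset.Icc 2 k, q.1 ^ (j - 2) * A a j (Real.cos q.2) (Real.sin q.2)
      + q.1 * ψ₃ q, min δ₁ (min δ₂ δ₃), by positivity, ⟨?_, ?_, ?_, ?_⟩, ?_, ?_, ?_⟩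
  · fun_prop
  · unfold A
    fun_prop
  · intro r θ _ hr
    have hp := hW.mem_nhds (hmem r θ (hr.trans_le (min_le_left _ _)))
    exact differentiableAt_normalForm k b a
      ((hR₂.contDiffAt hp).differentiableAt (by simp))
      ((hR₃.contDiffAt hp).differentiableAt (by simp))
  · intro r θ hr
    have hr₂ := h₂ r θ (hr.trans_le ((min_le_right _ _).trans (min_le_left _ _)))
    have hr₃ := h₃ r θ (hr.trans_le ((min_le_right _ _).trans (min_le_right _ _)))
    have hB : B k b (r * Real.sin θ) = r ^ 3 *
        ∑ i ∈ Finset.Icc 3 k, b i / (Nat.factorial i : ℝ) * (r ^ (i - 3) * Real.sin θ ^ i) := by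
      rw [B, Finset.mul_sum]
      refine Finset.sum_congr rfl fun i hi => ?_
      rw [mul_pow, ← Nat.sub_add_cancel (Finset.mem_Icc.1 hi).1, Nat.add_sub_cancel, pow_add r]
      ring
    have hA : ∑ j ∈ Finset.Icc 2 k, A a j (r * Real.cos θ) (r * Real.sin θ) = r ^ 2 *
        ∑ j ∈ Finset.Icc 2 k, r ^ (j - 2) * A a j (Real.cos θ) (Real.sin θ) := by
      rw [Finset.mul_sum]
      refine Finset.sum_congr rfl fun j hj => ?_
      rw [A_mul, ← mul_assoc, ← pow_add, Nat.add_sub_cancel' (Finset.mem_Icc.1 hj).1]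
    unfold normalForm
    rw [hr₂, hr₃]
    simp only [circle]
    rw [hB, hA]
    congr 3
    · ring
    · congr 1
      ring
  · exact fun r θ hr => hmem r θ (hr.trans_le (min_le_left _ _))
  · simp
  · intro θ
    simp only [zero_mul, add_zero]
    rw [Finset.sum_eq_single 2 _ (fun h => absurd (Finset.mem_Icc.2 ⟨le_rfl, hk⟩) h)]
    · simp
    · intro j hj hj2
      rw [zero_pow (by have := (Finset.mem_Icc.1 hj).1; omega), zero_mul]

/-! ### Values at `r = 0` -/

theorem calA_sq_pos (a₁₁ : ℝ) {a₀₂ : ℝ} (ha : 0 < a₀₂) (θ : ℝ) :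
    0 < Real.cos θ ^ 2 + (a₁₁ * Real.cos θ + a₀₂ * Real.sin θ) ^ 2 := by
  by_cases hc : Real.cos θ = 0
  · have hs : Real.sin θ ≠ 0 := fun hs => by simpa [hc, hs] using Real.cos_sq_add_sin_sq θ
    have : 0 < (a₀₂ * Real.sin θ) ^ 2 := sq_pos_of_ne_zero (mul_ne_zero ha.ne' hs)
    simpa [hc] using this
  · have : 0 < Real.cos θ ^ 2 := sq_pos_of_ne_zero hc
    positivity

theorem angularDeriv_eq_of_hasDerivAt {F : ℝ × ℝ → ℝ} (hF : ContDiff ℝ ∞ F) {φ : ℝ → ℝ}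
    {φ' r θ : ℝ} (h : ∀ θ, F (r, θ) = φ θ) (hφ : HasDerivAt φ φ' θ) :
    angularDeriv F (r, θ) = φ' := by
  rw [← funext h] at hφ
  exact (hasDerivAt_angular (hF.differentiable (by simp) (r, θ))).unique hφ

theorem hasDerivAt_quadratic_cos_sin (p q s θ : ℝ) :
    HasDerivAt (fun θ => p * Real.cos θ ^ 2 + q * (Real.cos θ * Real.sin θ) + s * Real.sin θ ^ 2)
      (-q * Real.sin θ ^ 2 + 2 * (s - p) * (Real.cos θ * Real.sin θ) + q * Real.cos θ ^ 2) θ := by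
  have hc := Real.hasDerivAt_cos θ
  have hs := Real.hasDerivAt_sin θ
  refine ((((hc.pow 2).const_mul p).add ((hc.mul hs).const_mul q)).add
    ((hs.pow 2).const_mul s)).congr_deriv ?_
  simp
  ring

/-- The angular derivative of a function that restricts to a quadratic form in `cos` and `sin`. -/
theorem angularDeriv_quadratic {F : ℝ × ℝ → ℝ} (hF : ContDiff ℝ ∞ F) {p q s r : ℝ}
    (h : ∀ θ, F (r, θ) =
      p * Real.cos θ ^ 2 + q * (Real.cos θ * Real.sin θ) + s * Real.sin θ ^ 2) (θ : ℝ) :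
    angularDeriv F (r, θ) =
      q * Real.cos θ ^ 2 + 2 * (s - p) * (Real.cos θ * Real.sin θ) + -q * Real.sin θ ^ 2 :=
  (angularDeriv_eq_of_hasDerivAt hF h (hasDerivAt_quadratic_cos_sin p q s θ)).trans (by ring)

theorem polarNormal_zero {P Q : ℝ × ℝ → ℝ} {a : ℕ → ℕ → ℝ} (hP : ContDiff ℝ ∞ P)
    (hQ : ContDiff ℝ ∞ Q) (hP0 : ∀ θ, P (0, θ) = Real.cos θ * Real.sin θ)
    (hQ0 : ∀ θ, Q (0, θ) = A a 2 (Real.cos θ) (Real.sin θ)) (θ : ℝ) :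
    polarNormal₂ Q (0, θ) = -(a 1 1 * Real.cos θ + a 0 2 * Real.sin θ) ∧
      polarNormal₃ P (0, θ) = Real.cos θ := by
  have hP1 := angularDeriv_quadratic hP (p := 0) (q := 1) (s := 0) (r := 0)
    (fun θ => by rw [hP0]; ring) θ
  have hQ1 := angularDeriv_quadratic hQ (p := a 2 0 / 2) (q := a 1 1) (s := a 0 2 / 2) (r := 0)
    (fun θ => by rw [hQ0, A_two]; ring) θ
  have hcs := Real.cos_sq_add_sin_sq θ
  simp only [polarNormal₂, polarNormal₃]
  rw [hP1, hQ1, hP0, hQ0, A_two]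
  constructor
  · linear_combination -(a 1 1 * Real.cos θ + a 0 2 * Real.sin θ) * hcs
  · linear_combination Real.cos θ * hcs

/-- The geodesic curvature in polar coordinates on `r = 0`. -/
theorem polarCurvature_zero {P Q : ℝ × ℝ → ℝ} {a : ℕ → ℕ → ℝ} (hP : ContDiff ℝ ∞ P)
    (hQ : ContDiff ℝ ∞ Q) (hP0 : ∀ θ, P (0, θ) = Real.cos θ * Real.sin θ)
    (hQ0 : ∀ θ, Q (0, θ) = A a 2 (Real.cos θ) (Real.sin θ)) {θ : ℝ} (hθ : Real.sin θ ≠ 0) :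
    polarCurvature P Q (0, θ) = leadingTerm (a 2 0) (a 1 1) (a 0 2) θ := by
  obtain ⟨hN₂, hN₃⟩ := polarNormal_zero hP hQ hP0 hQ0 θ
  have hP1 := angularDeriv_quadratic hP (p := 0) (q := 1) (s := 0) (r := 0)
    (fun θ => by rw [hP0]; ring)
  have hQ1 := angularDeriv_quadratic hQ (p := a 2 0 / 2) (q := a 1 1) (s := a 0 2 / 2) (r := 0)
    (fun θ => by rw [hQ0, A_two]; ring)
  -- The first derivative is again a quadratic form in `cos`, `sin`, so the same lemma gives the
  -- second.
  have hP2 := angularDeriv_quadratic (contDiff_angularDeriv hP) hP1 θ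
  have hQ2 := angularDeriv_quadratic (contDiff_angularDeriv hQ) hQ1 θ
  have hN : Real.sqrt (polarNormalSq P Q (0, θ)) = calA (a 1 1) (a 0 2) θ := by
    rw [polarNormalSq, hN₂, hN₃, calA]
    congr 1
    ring
  have hS : Real.sqrt (polarSpeedSq P Q (0, θ)) = |Real.sin θ| := by
    simp [polarSpeedSq, Real.sqrt_sq_eq_abs]
  have hT : polarTriple P Q (0, θ) =
      Real.sin θ ^ 4 * g (a 2 0) (a 1 1) (a 0 2) (Real.cos θ / Real.sin θ) := by
    rw [polarTriple, hN₂, hN₃, hP1, hQ1, hP2, hQ2, g]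
    field_simp
    ring
  have hs : |Real.sin θ|⁻¹ ^ 3 * Real.sin θ ^ 4 = |Real.sin θ| := by
    rw [← Even.pow_abs ⟨2, rfl⟩ (Real.sin θ)]
    have := abs_pos.2 hθ
    field_simp
  rw [polarCurvature, hN, hS, hT, leadingTerm]
  linear_combination (calA (a 1 1) (a 0 2) θ)⁻¹ *
    g (a 2 0) (a 1 1) (a 0 2) (Real.cos θ / Real.sin θ) * hs

/-! ### Uniformity in the angle and the error bound -/

theorem exists_pos_polarNormalSq_pos {f : ℝ × ℝ → E3} {P Q : ℝ × ℝ → ℝ} {δ : ℝ}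
    (h : IsPolarForm f P Q δ) (hδ : 0 < δ) (h0 : ∀ θ, 0 < polarNormalSq P Q (0, θ)) :
    ∃ ε, 0 < ε ∧ ε ≤ δ ∧ ∀ r θ, |r| < ε → 0 < polarNormalSq P Q (r, θ) := by
  have hopen : IsOpen {q | 0 < polarNormalSq P Q q} :=
    isOpen_lt continuous_const (contDiff_polarNormalSq h.smooth_snd h.smooth_thd).continuous
  obtain ⟨u, v, hu, -, h0u, hv, huv⟩ := generalized_tube_lemma (isCompact_singleton (x := (0 : ℝ)))
    (isCompact_Icc (a := (0 : ℝ)) (b := 2 * Real.pi)) hopen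
    (by rintro ⟨r, θ⟩ ⟨rfl, -⟩; exact h0 θ)
  obtain ⟨ε, hε, hεu⟩ := Metric.isOpen_iff.1 hu 0 (h0u rfl)
  refine ⟨min ε δ, lt_min hε hδ, min_le_right _ _, fun r θ hr => ?_⟩
  rcases eq_or_ne r 0 with rfl | hr0
  · exact h0 θ
  have hrpos := abs_pos.2 hr0
  have hrδ := hr.trans_le (min_le_right _ _)
  -- `P` and `Q` are not assumed periodic in `θ`. For `r ≠ 0` periodicity of `N` comes from
  -- geometry: `|r| √N` is the norm of the normal at `circle r θ`.
  obtain ⟨n, hn, -⟩ := existsUnique_add_zsmul_mem_Ico Real.two_pi_pos θ 0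
  rw [zero_add, zsmul_eq_mul] at hn
  have hpos : 0 < polarNormalSq P Q (r, θ + n * (2 * Real.pi)) :=
    huv ⟨hεu (by simpa using hr.trans_le (min_le_left _ _)), hv ⟨hn.1, hn.2.le⟩⟩
  have hcirc : circle r (θ + n * (2 * Real.pi)) = circle r θ := by
    rw [circle, Real.cos_add_int_mul_two_pi, Real.sin_add_int_mul_two_pi, circle]
  have e := h.norm_normalVector hrpos hrδ (θ + n * (2 * Real.pi))
  rw [hcirc, h.norm_normalVector hrpos hrδ] at e
  rw [← Real.sqrt_pos, mul_left_cancel₀ hrpos.ne' e]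
  exact Real.sqrt_pos.2 hpos

/-- A function of class `C¹` on the strips `|r| < ε`, `θ ∈ U` is Lipschitz in `r` at `r = 0`,
uniformly on smaller strips for `θ` in compact subsets of `U`. -/
theorem exists_bound_sub_zero {K : ℝ × ℝ → ℝ} {ε ρ : ℝ} (hρ : ρ < ε) {U : Set ℝ} (hU : IsOpen U)
    (hK : ContDiffOn ℝ 1 K {q | |q.1| < ε ∧ q.2 ∈ U}) {Θ : Set ℝ} (hΘ : IsCompact Θ)
    (hΘU : Θ ⊆ U) :
    ∃ C : ℝ, ∀ θ ∈ Θ, ∀ r : ℝ, |r| ≤ ρ → |K (r, θ) - K (0, θ)| ≤ C * |r| := by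
  have hopen : IsOpen {q : ℝ × ℝ | |q.1| < ε ∧ q.2 ∈ U} :=
    (isOpen_lt (continuous_abs.comp continuous_fst) continuous_const).inter
      (hU.preimage continuous_snd)
  have hc : ContinuousOn (radialDeriv K) {q : ℝ × ℝ | |q.1| < ε ∧ q.2 ∈ U} :=
    (hK.continuousOn_fderiv_of_isOpen hopen le_rfl).clm_apply continuousOn_const
  have hsub : Set.Icc (-ρ) ρ ×ˢ Θ ⊆ {q : ℝ × ℝ | |q.1| < ε ∧ q.2 ∈ U} := fun q hq =>
    ⟨(abs_le.2 hq.1).trans_lt hρ, hΘU hq.2⟩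
  obtain ⟨C, hC⟩ := (isCompact_Icc.prod hΘ).exists_bound_of_continuousOn (hc.mono hsub)
  refine ⟨C, fun θ hθ r hr => ?_⟩
  have hd : ∀ t ∈ Set.Icc (-ρ) ρ, HasDerivWithinAt (fun t => K (t, θ)) (radialDeriv K (t, θ))
      (Set.Icc (-ρ) ρ) t := fun t ht =>
    (hasDerivAt_radial (((hK.contDiffAt (hopen.mem_nhds (hsub ⟨ht, hθ⟩))).differentiableAt
      (by simp)))).hasDerivWithinAt
  have h0 : (0 : ℝ) ∈ Set.Icc (-ρ) ρ := by
    have := (abs_nonneg r).trans hr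
    constructor <;> linarith
  simpa using (convex_Icc (-ρ) ρ).norm_image_sub_le_of_norm_hasDerivWithin_le hd
    (fun t ht => hC (t, θ) ⟨ht, hθ⟩) h0 (abs_le.1 hr)

end WhitneyUmbrella

end

theorem theorem3p2 (k : ℕ) (hk : 3 ≤ k) (b : ℕ → ℝ) (a : ℕ → ℕ → ℝ) (ha : 0 < a 0 2)
    (W : Set (ℝ × ℝ)) (hW : IsOpen W) (h0 : (0 : ℝ × ℝ) ∈ W)
    (R₂ R₃ : ℝ × ℝ → ℝ)
    (hR₂ : ContDiffOn ℝ ∞ R₂ W) (hR₃ : ContDiffOn ℝ ∞ R₃ W)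
    (hO₂ : WhitneyUmbrella.HasOrderGE R₂ (k + 1))
    (hO₃ : WhitneyUmbrella.HasOrderGE R₃ (k + 1)) :
    ∃ ε : ℝ, 0 < ε ∧
      -- for `0 < |r| < ε` and `sin θ ≠ 0` the geodesic curvature is well defined:
      -- the circle lies in the domain, where `f₀` is immersive, and its image is regular
      (∀ r θ : ℝ, 0 < |r| → |r| < ε →
        WhitneyUmbrella.circle r θ ∈ W ∧
        WhitneyUmbrella.normalVector (WhitneyUmbrella.normalForm k b a R₂ R₃)
          (WhitneyUmbrella.circle r θ) ≠ 0 ∧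
        (Real.sin θ ≠ 0 →
          deriv (WhitneyUmbrella.normalForm k b a R₂ R₃ ∘ WhitneyUmbrella.circle r) θ ≠ 0)) ∧
      -- it is a smooth function of `(r, θ)`, up to and including `r = 0`
      (∃ K : ℝ × ℝ → ℝ,
        ContDiffOn ℝ ∞ K {q | |q.1| < ε ∧ Real.sin q.2 ≠ 0} ∧
        (∀ r θ : ℝ, 0 < |r| → |r| < ε → Real.sin θ ≠ 0 →
          K (r, θ) = WhitneyUmbrella.kappaG (WhitneyUmbrella.normalForm k b a R₂ R₃) r θ) ∧
        (∀ θ : ℝ, Real.sin θ ≠ 0 →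
          K (0, θ) = WhitneyUmbrella.leadingTerm (a 2 0) (a 1 1) (a 0 2) θ)) ∧
      -- the expansion, with error `O(r)` uniformly for `θ` in compact subsets of `sin θ ≠ 0`
      (∀ Θ : Set ℝ, IsCompact Θ → (∀ θ ∈ Θ, Real.sin θ ≠ 0) →
        ∃ C : ℝ, ∀ θ ∈ Θ, ∀ r : ℝ, 0 < |r| → |r| < ε →
          |WhitneyUmbrella.kappaG (WhitneyUmbrella.normalForm k b a R₂ R₃) r θ
            - WhitneyUmbrella.leadingTerm (a 2 0) (a 1 1) (a 0 2) θ| ≤ C * |r|) := by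
  obtain ⟨P, Q, δ, hδ, h, hδW, hP0, hQ0⟩ :=
    WhitneyUmbrella.exists_isPolarForm k (by omega) b a hW h0 hR₂ hR₃ hO₂ hO₃
  have hN0 : ∀ θ, 0 < WhitneyUmbrella.polarNormalSq P Q (0, θ) := fun θ => by
    obtain ⟨hN₂, hN₃⟩ :=
      WhitneyUmbrella.polarNormal_zero h.smooth_snd h.smooth_thd hP0 hQ0 θ
    have := WhitneyUmbrella.calA_sq_pos (a 1 1) ha θ
    rw [WhitneyUmbrella.polarNormalSq, hN₂, hN₃]
    linarith
  obtain ⟨ε, hε, hεδ, hN⟩ := WhitneyUmbrella.exists_pos_polarNormalSq_pos h hδ hN0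
  have hlt : ∀ r : ℝ, |r| < ε / 2 → |r| < ε := fun r hr => by linarith
  have hK : ContDiffOn ℝ ∞ (WhitneyUmbrella.polarCurvature P Q)
      {q | |q.1| < ε ∧ Real.sin q.2 ≠ 0} := fun q hq =>
    (WhitneyUmbrella.contDiffAt_polarCurvature h.smooth_snd h.smooth_thd
      (hN q.1 q.2 hq.1) hq.2).contDiffWithinAt
  -- Halving `ε` puts `|r| ≤ ε / 2` inside the strip of smoothness, so the radial derivative is
  -- bounded on a compact set.
  refine ⟨ε / 2, half_pos hε, fun r θ hr0 hr => ⟨?_, ?_, fun hθ => ?_⟩,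
    ⟨WhitneyUmbrella.polarCurvature P Q, hK.mono fun q hq => ⟨hlt _ hq.1, hq.2⟩,
      fun r θ hr0 hr _ => (h.kappaG_eq hr0 ((hlt r hr).trans_le hεδ) θ).symm,
      fun θ hθ => WhitneyUmbrella.polarCurvature_zero h.smooth_snd h.smooth_thd hP0 hQ0 hθ⟩,
    fun Θ hΘ hsin => ?_⟩
  · exact hδW r θ ((hlt r hr).trans_le hεδ)
  · rw [← norm_pos_iff, h.norm_normalVector hr0 ((hlt r hr).trans_le hεδ)]
    exact mul_pos hr0 (Real.sqrt_pos.2 (hN r θ (hlt r hr)))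
  · rw [← norm_pos_iff, h.norm_deriv ((hlt r hr).trans_le hεδ)]
    exact mul_pos hr0 (Real.sqrt_pos.2 (WhitneyUmbrella.polarSpeedSq_pos hθ))
  · obtain ⟨C, hC⟩ := WhitneyUmbrella.exists_bound_sub_zero (half_lt_self hε)
      (isOpen_ne_fun Real.continuous_sin continuous_const) (hK.of_le (by simp)) hΘ hsin
    refine ⟨C, fun θ hθ r hr0 hr => ?_⟩
    rw [h.kappaG_eq hr0 ((hlt r hr).trans_le hεδ), ← WhitneyUmbrella.polarCurvature_zero
      h.smooth_snd h.smooth_thd hP0 hQ0 (hsin θ hθ)]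
    exact hC θ hθ r hr.le
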